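/- Let $\nu$ be a finite positive Borel measure on $[0,2\pi)$, identified with the unit circle $\mathbb T$ via $\theta\mapsto e^{i\theta}$, and let $\mathbf H_2(d\nu)$ be the closed linear span in $\mathbf L_2(d\nu)$ of the functions $z^m$, $m\ge 0$ (with $z=e^{i\theta}$). Assume that $\mathbf H_2(d\nu)\neq\mathbf L_2(d\nu)$. Then $\mathbf H_2(d\nu)$ has a reproducing kernel on the open unit disc $\mathbb D$, in the following sense: for every $w\in\mathbb D$ the point evaluation $p\mapsto p(w)$ on polynomials extends to a bounded linear functional on $\mathbf H_2(d\nu)$, that is, there is $k_w\in\mathbf H_2(d\nu)$ with \[ \langle p,k_w\rangle_{\mathbf L_2(d\nu)}=p(w)\qquad\text{for all polynomials } p . \] Moreover there are functions $A$ and $B$, analytic in $\mathbb C\setminus\mathbb T$, such that the reproducing kernel $K(z,w)=\langle k_w,k_z\rangle_{\mathbf L_2(d\nu)}$ is \[ K(z,w)=\frac{A(z)A(w)^*-B(z)B(w)^*}{1-zw^*},\qquad z,w\in\mathbb D . \] If moreover $\nu$ is absolutely continuous with respect to Lebesgue measure $d\theta$, then an element $f\in\mathbf H_2(d\nu)$ is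 determined by its values $f(w)=\langle f,k_w\rangle$, $w\in\mathbb D$. In that case $\mathbf H_2(d\nu)$ is a reproducing kernel Hilbert space of functions on $\mathbb D$, in which every polynomial is represented by itself, and its reproducing kernel is $K$. -/

import Mathlib

open MeasureTheory ComplexConjugate

noncomputable section

instance factTwoPiPos : Fact (0 < 2 * Real.pi) := ⟨Real.two_pi_pos⟩

/-- The space `L²(dν)` of a measure `ν` on `[0, 2π)`, that is, on the circle `ℝ / 2πℤ`. -/
abbrev LTwo (ν : Measure (AddCircle (2 * Real.pi))) : Type := Lp ℂ 2 ν

/-- The function `θ ↦ p(e^{iθ})` on the circle, for a polynomial `p`. -/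
def polyOnCircle (p : Polynomial ℂ) : C(AddCircle (2 * Real.pi), ℂ) where
  toFun θ := p.eval (fourier 1 θ)
  continuous_toFun := p.continuous.comp (fourier 1).continuous

/-- The class in `L²(dν)` of the boundary function `θ ↦ p(e^{iθ})` of a polynomial `p`. -/
def polyLTwo (ν : Measure (AddCircle (2 * Real.pi))) [IsFiniteMeasure ν] (p : Polynomial ℂ) :
    LTwo ν :=
  ContinuousMap.toLp (E := ℂ) 2 ν ℂ (polyOnCircle p)

/-- The space `H₂(dν)`: the closed linear span in `L²(dν)` of the functions `z ^ m`, `m ≥ 0`. -/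
def HTwo (ν : Measure (AddCircle (2 * Real.pi))) [IsFiniteMeasure ν] : Submodule ℂ (LTwo ν) :=
  (Submodule.span ℂ (Set.range fun m : ℕ => polyLTwo ν (Polynomial.X ^ m))).topologicalClosure

instance HTwo.instCompleteSpace (ν : Measure (AddCircle (2 * Real.pi))) [IsFiniteMeasure ν] :
    CompleteSpace (HTwo ν) :=
  (Submodule.isClosed_topologicalClosure _).completeSpace_coe

theorem polyLTwo_mem_HTwo (ν : Measure (AddCircle (2 * Real.pi))) [IsFiniteMeasure ν]
    (p : Polynomial ℂ) : polyLTwo ν p ∈ HTwo ν := by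
  apply Submodule.le_topologicalClosure
  induction p using Polynomial.induction_on' with
  | add p q hp hq =>
    have h : polyLTwo ν (p + q) = polyLTwo ν p + polyLTwo ν q := by
      have h0 : polyOnCircle (p + q) = polyOnCircle p + polyOnCircle q := by
        ext θ; simp [polyOnCircle]
      rw [polyLTwo, h0, map_add]; rfl
    rw [h]
    exact Submodule.add_mem _ hp hq
  | monomial n a =>
    have h : polyLTwo ν (Polynomial.monomial n a) = a • polyLTwo ν (Polynomial.X ^ n) := by
      have h0 : polyOnCircle (Polynomial.monomial n a) = a • polyOnCircle (Polynomial.X ^ n) := by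
        ext θ; simp [polyOnCircle]
      rw [polyLTwo, h0, map_smul]; rfl
    rw [h]
    exact Submodule.smul_mem _ _ (Submodule.subset_span ⟨n, rfl⟩)

/-- A polynomial, viewed as an element of `H₂(dν)`. -/
def polyHTwo (ν : Measure (AddCircle (2 * Real.pi))) [IsFiniteMeasure ν] (p : Polynomial ℂ) :
    HTwo ν :=
  ⟨polyLTwo ν p, polyLTwo_mem_HTwo ν p⟩

/-- `k` is the family of reproducing vectors `k_w`, `|w| < 1`, of `H₂(dν)`: for every `w` the
evaluation `p ↦ p(w)` of polynomials extends to the bounded functional `f ↦ ⟨f, k_w⟩` on `H₂(dν)`.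
(Mathlib's inner product is conjugate-linear in its first entry.) -/
def IsReproducingFamily (ν : Measure (AddCircle (2 * Real.pi))) [IsFiniteMeasure ν]
    (k : Metric.ball (0 : ℂ) 1 → HTwo ν) : Prop :=
  ∀ (w : Metric.ball (0 : ℂ) 1) (p : Polynomial ℂ), inner ℂ (k w) (polyHTwo ν p) = p.eval (w : ℂ)

/-- The kernel `(A(z) A(w)* - B(z) B(w)*) / (1 - z w*)`. -/
def differenceKernel (A B : ℂ → ℂ) (z w : ℂ) : ℂ :=
  (A z * conj (A w) - B z * conj (B w)) / (1 - z * conj w)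

end

/-! Multiplication by `z` is an isometry of `H₂(dν)`. If it were onto, `H₂(dν)` would contain all
the `e^{inθ}` and be `L²(dν)`; hence there is a unit vector `e ⟂ z H₂(dν)`. The functions
`e, ze, z²e, …` are orthonormal, and `c_w = ∑ w̄ⁿ zⁿ e` satisfies `⟨z f, c_w⟩ = w ⟨f, c_w⟩`, so that
`⟨p, c_w⟩ = p(w) ⟨1, c_w⟩` for polynomials `p`. As these are dense and `c_w ≠ 0`, the number
`⟨1, c_w⟩` is not zero, and `k_w` is a multiple of `c_w`. Since `⟨c_w, c_z⟩ = 1 / (1 - z w̄)`, the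
kernel has the asserted form with `A(z) = 1 / ⟨1, c_z⟩` and `B = 0`.

If `f` is orthogonal to all `k_w`, then all Fourier coefficients of `ē f dν` vanish: those of
index `n ≥ 0` are the coefficients of the power series `⟨f, c_w⟩`, the others vanish because
`e ⟂ z H₂(dν)`. So `ē f = 0`. For the same reason `|e|² dν` is the normalised Lebesgue measure; if
`ν` is absolutely continuous, this forces `e ≠ 0` almost everywhere, and then `f = 0`. -/

noncomputable section

section SzegoVector

variable {𝕜 E : Type*} [RCLike 𝕜] [NormedAddCommGroup E] [InnerProductSpace 𝕜 E]
  {v : ℕ → E} {w : 𝕜}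

/-- The Szegő kernel function `∑ w̄ⁿ vₙ` at the point `w` of the Hardy space with basis `v`: pairing
with it turns `f` into the power series `∑ ⟪vₙ, f⟫ wⁿ`. -/
def szegoVector (v : ℕ → E) (w : 𝕜) : E := ∑' n, conj w ^ n • v n

theorem hasSum_szegoVector [CompleteSpace E] (hv : Orthonormal 𝕜 v) (hw : ‖w‖ < 1) :
    HasSum (fun n => conj w ^ n • v n) (szegoVector v w) := by
  refine (Summable.of_norm ?_).hasSum
  simpa [norm_smul, hv.1] using summable_geometric_of_lt_one (norm_nonneg w) hw

theorem hasSum_inner_szegoVector [CompleteSpace E] (hv : Orthonormal 𝕜 v) (hw : ‖w‖ < 1) (f : E) :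
    HasSum (fun n => w ^ n * inner 𝕜 (v n) f) (inner 𝕜 (szegoVector v w) f) := by
  have h := ((hasSum_szegoVector hv hw).mapL (innerSL 𝕜 f)).star
  simpa [inner_smul_right, inner_conj_symm] using h

theorem hasFPowerSeriesOnBall_inner_szegoVector [CompleteSpace E] (hv : Orthonormal 𝕜 v) (f : E) :
    HasFPowerSeriesOnBall (fun w => inner 𝕜 (szegoVector v w) f)
      (FormalMultilinearSeries.ofScalars 𝕜 fun n => inner 𝕜 (v n) f) 0 1 where
  r_le := by
    refine FormalMultilinearSeries.le_radius_of_bound (r := 1) _ ‖f‖ fun n => ?_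
    rw [FormalMultilinearSeries.ofScalars_norm]
    simpa [hv.1] using norm_inner_le_norm (𝕜 := 𝕜) (v n) f
  r_pos := one_pos
  hasSum := by
    intro w hw
    rw [← ENNReal.ofReal_one, Metric.eball_ofReal, mem_ball_zero_iff] at hw
    simpa [mul_comm] using hasSum_inner_szegoVector hv hw f

theorem differentiableOn_inner_szegoVector [CompleteSpace E] (hv : Orthonormal 𝕜 v) (f : E) :
    DifferentiableOn 𝕜 (fun w : 𝕜 => inner 𝕜 (szegoVector v w) f) (Metric.ball 0 1) := by
  rw [← Metric.eball_ofReal, ENNReal.ofReal_one]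
  exact (hasFPowerSeriesOnBall_inner_szegoVector hv f).differentiableOn

theorem inner_eq_zero_of_inner_szegoVector_eq_zero [CompleteSpace E] (hv : Orthonormal 𝕜 v) {f : E}
    (hf : ∀ w : 𝕜, ‖w‖ < 1 → inner 𝕜 (szegoVector v w) f = 0) (n : ℕ) : inner 𝕜 (v n) f = 0 := by
  have hzero : (fun w : 𝕜 => inner 𝕜 (szegoVector v w) f) =ᶠ[nhds 0] 0 := by
    filter_upwards [Metric.ball_mem_nhds (0 : 𝕜) one_pos] with w hw
    exact hf w (mem_ball_zero_iff.1 hw)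
  have hseries :=
    ((hasFPowerSeriesOnBall_inner_szegoVector hv f).hasFPowerSeriesAt.congr hzero).eq_zero
  exact congrFun ((FormalMultilinearSeries.ofScalars_series_eq_zero 𝕜).1 hseries) n

theorem inner_apply_szegoVector [CompleteSpace E] (hv : Orthonormal 𝕜 v) (hw : ‖w‖ < 1) (n : ℕ) :
    inner 𝕜 (v n) (szegoVector v w) = conj w ^ n := by
  have h := hasSum_single n fun m hm => show w ^ m * inner 𝕜 (v m) (v n) = 0 by
    rw [hv.2 hm, mul_zero]
  rw [← inner_conj_symm, (hasSum_inner_szegoVector hv hw (v n)).unique h,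
    inner_self_eq_norm_sq_to_K, hv.1]
  simp

theorem szegoVector_ne_zero [CompleteSpace E] (hv : Orthonormal 𝕜 v) (hw : ‖w‖ < 1) :
    szegoVector v w ≠ 0 := fun h => by
  simpa [h] using inner_apply_szegoVector hv hw 0

theorem inner_szegoVector_szegoVector [CompleteSpace E] (hv : Orthonormal 𝕜 v) {z : 𝕜}
    (hz : ‖z‖ < 1) (hw : ‖w‖ < 1) :
    inner 𝕜 (szegoVector v z) (szegoVector v w) = (1 - z * conj w)⁻¹ := by
  have hlt : ‖z * conj w‖ < 1 := by
    rw [norm_mul, RCLike.norm_conj]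
    exact mul_lt_one_of_nonneg_of_lt_one_left (norm_nonneg z) hz hw.le
  refine (hasSum_inner_szegoVector hv hz _).unique ?_
  simpa only [inner_apply_szegoVector hv hw, mul_pow] using hasSum_geometric_of_norm_lt_one hlt

end SzegoVector

section Wandering

variable {𝕜 E : Type*} [RCLike 𝕜] [NormedAddCommGroup E] [InnerProductSpace 𝕜 E]
  {T : E →ₗᵢ[𝕜] E} {e u : E} {w : 𝕜}

/-- `e` is a unit vector of the wandering subspace `E ⊖ T E` of the isometry `T`. -/
structure IsUnitWandering (T : E →ₗᵢ[𝕜] E) (e : E) : Prop where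
  norm_eq_one : ‖e‖ = 1
  inner_map_eq_zero (x : E) : inner 𝕜 e (T x) = 0

theorem exists_isUnitWandering [CompleteSpace E] (hT : ¬ Function.Surjective T) :
    ∃ e, IsUnitWandering T e := by
  have : CompleteSpace T.range := T.isometry.isClosedEmbedding.isClosed_range.completeSpace_coe
  have hne : T.rangeᗮ ≠ ⊥ := by
    rwa [Ne, Submodule.orthogonal_eq_bot_iff, LinearMap.range_eq_top]
  obtain ⟨x, hx, hx0⟩ := Submodule.exists_mem_ne_zero_of_ne_bot hne
  refine ⟨(‖x‖⁻¹ : 𝕜) • x, norm_smul_inv_norm hx0, fun y => ?_⟩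
  have hxy : inner 𝕜 x (T y) = 0 := (Submodule.mem_orthogonal' _ _).1 hx _ ⟨y, rfl⟩
  rw [inner_smul_left, hxy, mul_zero]

/-- The Szegő kernel function at `w` of the orthonormal sequence `Tⁿ e`, for a unit wandering vector
`e` of `T`. -/
def wanderingKernel (T : E →ₗᵢ[𝕜] E) (e : E) (w : 𝕜) : E := szegoVector (fun n => (T ^ n) e) w

/-- The multiple of `wanderingKernel T e w` which represents the evaluation `p(T) u ↦ p(w)`. -/
def evalVector (T : E →ₗᵢ[𝕜] E) (e u : E) (w : 𝕜) : E :=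
  conj (inner 𝕜 (wanderingKernel T e w) u)⁻¹ • wanderingKernel T e w

namespace IsUnitWandering

theorem inner_pow_succ (he : IsUnitWandering T e) (n : ℕ) (x : E) :
    inner 𝕜 e ((T ^ (n + 1)) x) = 0 := by
  rw [pow_succ']
  exact he.inner_map_eq_zero _

theorem orthonormal_pow (he : IsUnitWandering T e) : Orthonormal 𝕜 fun n => (T ^ n) e := by
  have hlt (m k : ℕ) : inner 𝕜 ((T ^ m) e) ((T ^ (m + (k + 1))) e) = 0 := by
    rw [pow_add, LinearIsometry.coe_mul, Function.comp_apply, LinearIsometry.inner_map_map,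
      he.inner_pow_succ]
  refine ⟨fun n => by rw [LinearIsometry.norm_map, he.norm_eq_one], fun m n hmn => ?_⟩
  rcases hmn.lt_or_gt with h | h <;> obtain ⟨k, rfl⟩ := Nat.exists_eq_add_of_lt h
  · exact hlt m k
  · exact inner_eq_zero_symm.1 (hlt n k)

variable [CompleteSpace E]

/-- In the power series of `T f` the constant term vanishes, as `e` is orthogonal to the range of
`T`, and the others are those of `f`, shifted. -/
theorem inner_wanderingKernel_map (he : IsUnitWandering T e) (hw : ‖w‖ < 1) (f : E) :
    inner 𝕜 (wanderingKernel T e w) (T f) = w * inner 𝕜 (wanderingKernel T e w) f := by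
  have hzero : w ^ 0 * inner 𝕜 ((T ^ 0) e) (T f) = 0 := by
    rw [pow_zero T, LinearIsometry.coe_one, id, he.inner_map_eq_zero, mul_zero]
  have hshift (n : ℕ) :
      w * (w ^ n * inner 𝕜 ((T ^ n) e) f) = w ^ (n + 1) * inner 𝕜 ((T ^ (n + 1)) e) (T f) := by
    rw [pow_succ' T, LinearIsometry.coe_mul, Function.comp_apply, LinearIsometry.inner_map_map,
      pow_succ', mul_assoc]
  have hfsum := (hasSum_inner_szegoVector he.orthonormal_pow hw f).mul_left w
  simp only [hshift] at hfsum
  have hmapsum := hasSum_inner_szegoVector he.orthonormal_pow hw (T f)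
  rw [← hasSum_nat_add_iff' 1, Finset.sum_range_one, hzero, sub_zero] at hmapsum
  exact hmapsum.unique hfsum

theorem inner_wanderingKernel_aeval (he : IsUnitWandering T e) (hw : ‖w‖ < 1)
    (p : Polynomial 𝕜) (f : E) :
    inner 𝕜 (wanderingKernel T e w) (Polynomial.aeval T.toLinearMap p f) =
      p.eval w * inner 𝕜 (wanderingKernel T e w) f := by
  induction p using Polynomial.induction_on with
  | C a => simp [inner_smul_right]
  | add p q hp hq =>
    rw [map_add, LinearMap.add_apply, inner_add_right, hp, hq, Polynomial.eval_add, add_mul]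
  | monomial n a h =>
    rw [pow_succ', mul_left_comm, map_mul, Polynomial.aeval_X, Module.End.mul_apply,
      LinearIsometry.coe_toLinearMap, he.inner_wanderingKernel_map hw, h,
      Polynomial.eval_mul (p := Polynomial.X), Polynomial.eval_X, mul_assoc]

theorem inner_wanderingKernel_wanderingKernel (he : IsUnitWandering T e) {z : 𝕜} (hz : ‖z‖ < 1)
    (hw : ‖w‖ < 1) :
    inner 𝕜 (wanderingKernel T e z) (wanderingKernel T e w) = (1 - z * conj w)⁻¹ :=
  inner_szegoVector_szegoVector he.orthonormal_pow hz hw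

theorem wanderingKernel_ne_zero (he : IsUnitWandering T e) (hw : ‖w‖ < 1) :
    wanderingKernel T e w ≠ 0 :=
  szegoVector_ne_zero he.orthonormal_pow hw

theorem inner_wanderingKernel_ne_zero (he : IsUnitWandering T e)
    (hu : ∀ x, (∀ p : Polynomial 𝕜, inner 𝕜 x (Polynomial.aeval T.toLinearMap p u) = 0) → x = 0)
    (hw : ‖w‖ < 1) : inner 𝕜 (wanderingKernel T e w) u ≠ 0 := fun h =>
  he.wanderingKernel_ne_zero hw <| hu _ fun p => by
    rw [he.inner_wanderingKernel_aeval hw, h, mul_zero]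

theorem inner_evalVector_aeval (he : IsUnitWandering T e)
    (hu : inner 𝕜 (wanderingKernel T e w) u ≠ 0) (hw : ‖w‖ < 1) (p : Polynomial 𝕜) :
    inner 𝕜 (evalVector T e u w) (Polynomial.aeval T.toLinearMap p u) = p.eval w := by
  rw [evalVector, inner_smul_left, RCLike.conj_conj, he.inner_wanderingKernel_aeval hw,
    mul_left_comm, inv_mul_cancel₀ hu, mul_one]

theorem inner_evalVector_evalVector (he : IsUnitWandering T e) {z : 𝕜} (hz : ‖z‖ < 1)
    (hw : ‖w‖ < 1) :
    inner 𝕜 (evalVector T e u z) (evalVector T e u w) =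
      (inner 𝕜 (wanderingKernel T e z) u)⁻¹ * conj (inner 𝕜 (wanderingKernel T e w) u)⁻¹ /
        (1 - z * conj w) := by
  rw [evalVector, evalVector, inner_smul_left, inner_smul_right, RCLike.conj_conj,
    he.inner_wanderingKernel_wanderingKernel hz hw, ← mul_assoc, div_eq_mul_inv]

end IsUnitWandering

end Wandering

section FourierUniqueness

open scoped BoundedContinuousFunction NNReal

theorem ae_eq_zero_of_forall_integral_boundedContinuous_smul_eq_zero {X E : Type*}
    [TopologicalSpace X] [MeasurableSpace X] [BorelSpace X] [HasOuterApproxClosed X]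
    [NormedAddCommGroup E] [NormedSpace ℝ E] [CompleteSpace E] {μ : Measure X} {g : X → E}
    (hg : Integrable g μ) (h : ∀ φ : X →ᵇ ℝ≥0, ∫ x, φ x • g x ∂μ = 0) : g =ᵐ[μ] 0 := by
  refine ae_eq_zero_of_forall_setIntegral_isClosed_eq_zero hg fun s hs => ?_
  have hlim : Filter.Tendsto (fun n => ∫ x, hs.apprSeq n x • g x ∂μ) Filter.atTop
      (nhds (∫ x, s.indicator (fun _ => (1 : ℝ≥0)) x • g x ∂μ)) := by
    refine tendsto_integral_of_dominated_convergence (fun x => ‖g x‖) (fun n => ?_) hg.norm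
      (fun n => ae_of_all _ fun x => ?_) (ae_of_all _ fun x => ?_)
    · exact (hs.apprSeq n).continuous.measurable.aestronglyMeasurable.smul hg.aestronglyMeasurable
    · rw [NNReal.smul_def, norm_smul, NNReal.norm_eq]
      exact mul_le_of_le_one_left (norm_nonneg _)
        (HasOuterApproxClosed.apprSeq_apply_le_one hs n x)
    · exact ((tendsto_pi_nhds.1 (HasOuterApproxClosed.tendsto_apprSeq hs)) x).smul_const (g x)
  simp only [h, ← Set.indicator_smul_apply_left, one_smul] at hlim
  rw [integral_indicator hs.measurableSet] at hlim
  exact tendsto_nhds_unique hlim tendsto_const_nhds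

variable {T : ℝ} [Fact (0 < T)]

theorem ae_eq_zero_of_integral_fourier_mul_eq_zero {μ : Measure (AddCircle T)} [IsFiniteMeasure μ]
    {g : AddCircle T → ℂ} (hg : Integrable g μ)
    (h : ∀ n : ℤ, ∫ θ, fourier n θ * g θ ∂μ = 0) : g =ᵐ[μ] 0 := by
  let Λ : C(AddCircle T, ℂ) →L[ℂ] ℂ :=
    ((ContinuousLinearMap.mul ℂ ℂ).lpPairing μ ⊤ 1).flip (hg.toL1 g) ∘L
      ContinuousMap.toLp (E := ℂ) ⊤ μ ℂ
  have hΛ (φ : C(AddCircle T, ℂ)) : Λ φ = ∫ θ, φ θ * g θ ∂μ := by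
    refine (ContinuousLinearMap.lpPairing_eq_integral _ _ _).trans (integral_congr_ae ?_)
    filter_upwards [ContinuousMap.coeFn_toLp (p := ⊤) (𝕜 := ℂ) μ φ, hg.coeFn_toL1] with θ hφ hθ
    exact congrArg₂ (· * ·) hφ hθ
  have hdense : Dense (Submodule.span ℂ (Set.range (@fourier T)) : Set C(AddCircle T, ℂ)) :=
    Submodule.dense_iff_topologicalClosure_eq_top.2 span_fourier_closure_eq_top
  have hzero : Λ = 0 := by
    refine ContinuousLinearMap.ext_on hdense ?_
    rintro _ ⟨n, rfl⟩
    rw [hΛ, h, zero_apply]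
  refine ae_eq_zero_of_forall_integral_boundedContinuous_smul_eq_zero hg fun φ => ?_
  have hφ := hΛ ⟨fun θ => ((φ θ : ℝ) : ℂ), by fun_prop⟩
  rw [hzero, zero_apply] at hφ
  exact hφ.symm

theorem integral_fourier_haarAddCircle (n : ℤ) :
    ∫ θ : AddCircle T, fourier n θ ∂AddCircle.haarAddCircle = if n = 0 then 1 else 0 := by
  simpa [fourierCoeff, Pi.single_apply, eq_comm] using congrFun (fourierCoeff_fourier (T := T) n) 0

end FourierUniqueness

section FourierMul

open AddCircle (haarAddCircle)

variable {T : ℝ} [Fact (0 < T)] (μ : Measure (AddCircle T)) [IsFiniteMeasure μ]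
  {p : ENNReal} [Fact (1 ≤ p)]

theorem topologicalClosure_span_toLp_fourier (hp : p ≠ ⊤) :
    (Submodule.span ℂ (Set.range fun n : ℤ =>
      ContinuousMap.toLp (E := ℂ) p μ ℂ (fourier n))).topologicalClosure = ⊤ := by
  have h := (ContinuousMap.toLp_denseRange ℂ μ ℂ hp).topologicalClosure_map_submodule
    (span_fourier_closure_eq_top (T := T))
  rwa [Submodule.map_span, ← Set.range_comp] at h

/-- Multiplication by the Fourier monomial `fourier n` on `Lᵖ(μ)`. -/
def fourierMul (n : ℤ) : Lp ℂ p μ →L[ℂ] Lp ℂ p μ :=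
  (ContinuousLinearMap.mul ℂ ℂ).holderL μ ⊤ p p (ContinuousMap.toLp (E := ℂ) ⊤ μ ℂ (fourier n))

theorem coeFn_fourierMul (n : ℤ) (f : Lp ℂ p μ) :
    fourierMul μ n f =ᵐ[μ] fun θ => fourier n θ * f θ := by
  filter_upwards [(ContinuousLinearMap.mul ℂ ℂ).coeFn_holder (r := p)
      (ContinuousMap.toLp (E := ℂ) ⊤ μ ℂ (fourier n)) f,
    ContinuousMap.coeFn_toLp (E := ℂ) (p := ⊤) (𝕜 := ℂ) μ (fourier n)] with θ hmul hfourier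
  rw [ContinuousLinearMap.mul_apply', hfourier] at hmul
  exact hmul

theorem fourierMul_zero (f : Lp ℂ p μ) : fourierMul μ 0 f = f := by
  apply Lp.ext
  filter_upwards [coeFn_fourierMul μ 0 f] with θ h
  rw [h, fourier_zero, one_mul]

theorem fourierMul_fourierMul (m n : ℤ) (f : Lp ℂ p μ) :
    fourierMul μ m (fourierMul μ n f) = fourierMul μ (m + n) f := by
  apply Lp.ext
  filter_upwards [coeFn_fourierMul μ m (fourierMul μ n f), coeFn_fourierMul μ n f,
    coeFn_fourierMul μ (m + n) f] with θ hm hn hmn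
  rw [hm, hn, hmn, fourier_add, mul_assoc]

theorem fourierMul_toLp (n : ℤ) (f : C(AddCircle T, ℂ)) :
    fourierMul μ n (ContinuousMap.toLp (E := ℂ) p μ ℂ f) =
      ContinuousMap.toLp (E := ℂ) p μ ℂ (fourier n * f) := by
  apply Lp.ext
  filter_upwards [coeFn_fourierMul μ n (ContinuousMap.toLp (E := ℂ) p μ ℂ f),
    ContinuousMap.coeFn_toLp (E := ℂ) (p := p) (𝕜 := ℂ) μ f,
    ContinuousMap.coeFn_toLp (E := ℂ) (p := p) (𝕜 := ℂ) μ (fourier n * f)] with θ hmul hf hnf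
  rw [hmul, hf, hnf, ContinuousMap.mul_apply]

theorem inner_fourierMul_eq_integral (n : ℤ) (f g : Lp ℂ 2 μ) :
    inner ℂ (fourierMul μ n f) g = ∫ θ, fourier (-n) θ * inner ℂ (f θ) (g θ) ∂μ := by
  rw [L2.inner_def]
  apply integral_congr_ae
  filter_upwards [coeFn_fourierMul μ n f] with θ h
  rw [h, fourier_neg, ← smul_eq_mul (fourier n θ), inner_smul_left]

theorem inner_fourierMul_fourierMul (n : ℤ) (f g : Lp ℂ 2 μ) :
    inner ℂ (fourierMul μ n f) (fourierMul μ n g) = inner ℂ f g := by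
  rw [inner_fourierMul_eq_integral, L2.inner_def]
  apply integral_congr_ae
  filter_upwards [coeFn_fourierMul μ n g] with θ h
  rw [h, ← smul_eq_mul (fourier n θ), inner_smul_right, ← mul_assoc, ← fourier_add,
    neg_add_cancel, fourier_zero, one_mul]

theorem inner_fourierMul_left (n : ℤ) (f g : Lp ℂ 2 μ) :
    inner ℂ (fourierMul μ n f) g = inner ℂ f (fourierMul μ (-n) g) := by
  rw [← inner_fourierMul_fourierMul μ (-n), fourierMul_fourierMul, neg_add_cancel,
    fourierMul_zero]

variable {μ} {e f : Lp ℂ 2 μ}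

theorem ae_inner_eq_zero_of_inner_fourierMul_eq_zero
    (h : ∀ n : ℤ, inner ℂ (fourierMul μ n e) f = 0) : ∀ᵐ θ ∂μ, inner ℂ (e θ) (f θ) = 0 := by
  refine ae_eq_zero_of_integral_fourier_mul_eq_zero (L2.integrable_inner e f) fun n => ?_
  rw [← neg_neg n, ← inner_fourierMul_eq_integral, h]

theorem ae_rnDeriv_haarAddCircle_smul_inner_eq_one (hμ : μ ≪ haarAddCircle)
    (he : ‖e‖ = 1) (h : ∀ n : ℤ, n ≠ 0 → inner ℂ (fourierMul μ n e) e = 0) :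
    ∀ᵐ θ ∂haarAddCircle,
      (μ.rnDeriv haarAddCircle θ).toReal • inner ℂ (e θ) (e θ) = 1 := by
  set ρ : AddCircle T → ℝ := fun θ => (μ.rnDeriv haarAddCircle θ).toReal
  have hint : Integrable (fun θ => ρ θ • inner ℂ (e θ) (e θ)) haarAddCircle :=
    (integrable_rnDeriv_smul_iff hμ).2 (L2.integrable_inner e e)
  have hcoeff (n : ℤ) : ∫ θ, fourier n θ * ρ θ • inner ℂ (e θ) (e θ) ∂haarAddCircle =
      if n = 0 then 1 else 0 := by
    simp only [mul_smul_comm]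
    rw [integral_rnDeriv_smul hμ, ← neg_neg n, ← inner_fourierMul_eq_integral, neg_neg]
    split_ifs with hn
    · rw [hn, neg_zero, fourierMul_zero, inner_self_eq_norm_sq_to_K, he]
      simp
    · exact h _ (by simpa using hn)
  have hzero : (fun θ => ρ θ • inner ℂ (e θ) (e θ) - 1) =ᵐ[haarAddCircle] 0 := by
    refine ae_eq_zero_of_integral_fourier_mul_eq_zero (hint.sub (integrable_const 1)) fun n => ?_
    have hfourier : Integrable (fun θ => fourier n θ) (haarAddCircle (T := T)) :=
      (fourier n).continuous.integrable_of_hasCompactSupport (.of_compactSpace _)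
    have hmul : Integrable (fun θ => fourier n θ * ρ θ • inner ℂ (e θ) (e θ))
        haarAddCircle := hint.fourier_smul n
    simp only [mul_sub, mul_one]
    rw [integral_sub hmul hfourier, hcoeff, integral_fourier_haarAddCircle, sub_self]
  filter_upwards [hzero] with θ hθ
  exact sub_eq_zero.1 hθ

theorem eq_zero_of_inner_fourierMul_eq_zero (hμ : μ ≪ haarAddCircle) (he : ‖e‖ = 1)
    (hee : ∀ n : ℤ, n ≠ 0 → inner ℂ (fourierMul μ n e) e = 0)
    (hef : ∀ n : ℤ, inner ℂ (fourierMul μ n e) f = 0) : f = 0 := by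
  rw [Lp.eq_zero_iff_ae_eq_zero]
  filter_upwards [ae_inner_eq_zero_of_inner_fourierMul_eq_zero hef,
    hμ.ae_le (ae_rnDeriv_haarAddCircle_smul_inner_eq_one hμ he hee)] with θ hf hone
  have hne : e θ ≠ 0 := fun h0 => by simp [h0] at hone
  simpa [hne] using hf

end FourierMul

section ShiftHTwo

variable (ν : Measure (AddCircle (2 * Real.pi))) [IsFiniteMeasure ν]

theorem polyLTwo_X_mul (p : Polynomial ℂ) :
    polyLTwo ν (Polynomial.X * p) = fourierMul ν 1 (polyLTwo ν p) := by
  rw [polyLTwo, polyLTwo, fourierMul_toLp]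
  congr 1
  ext θ
  simp [polyOnCircle]

variable {ν}

theorem HTwo_le_of_forall_polyLTwo_mem {S : Submodule ℂ (LTwo ν)} (hS : IsClosed (S : Set (LTwo ν)))
    (h : ∀ p : Polynomial ℂ, polyLTwo ν p ∈ S) : HTwo ν ≤ S := by
  refine Submodule.topologicalClosure_minimal _ (Submodule.span_le.2 ?_) hS
  rintro _ ⟨m, rfl⟩
  exact h (Polynomial.X ^ m)

theorem fourierMul_one_mem_HTwo {f : LTwo ν} (hf : f ∈ HTwo ν) : fourierMul ν 1 f ∈ HTwo ν := by
  have hclosed : IsClosed ((HTwo ν).comap (fourierMul ν 1).toLinearMap : Set (LTwo ν)) :=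
    (Submodule.isClosed_topologicalClosure _).preimage (fourierMul ν 1).continuous
  refine HTwo_le_of_forall_polyLTwo_mem hclosed (fun p => ?_) hf
  change fourierMul ν 1 (polyLTwo ν p) ∈ HTwo ν
  rw [← polyLTwo_X_mul]
  exact polyLTwo_mem_HTwo ν _

theorem eq_zero_of_inner_polyHTwo_eq_zero {f : HTwo ν}
    (hf : ∀ p : Polynomial ℂ, inner ℂ f (polyHTwo ν p) = 0) : f = 0 := by
  have hff := HTwo_le_of_forall_polyLTwo_mem (Submodule.isClosed_orthogonal (ℂ ∙ (f : LTwo ν)))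
    (fun p => Submodule.mem_orthogonal_singleton_iff_inner_right.2 (hf p)) f.2
  rw [Submodule.mem_orthogonal_singleton_iff_inner_right, inner_self_eq_zero] at hff
  exact Subtype.ext hff

variable (ν)

/-- The isometry `f ↦ z f` of `H₂(dν)`. -/
def shiftHTwo : HTwo ν →ₗᵢ[ℂ] HTwo ν :=
  ((fourierMul ν 1).toLinearMap.restrict fun _ hf => fourierMul_one_mem_HTwo hf).isometryOfInner
    fun f g => inner_fourierMul_fourierMul ν 1 (f : LTwo ν) g

theorem coe_shiftHTwo (f : HTwo ν) : (shiftHTwo ν f : LTwo ν) = fourierMul ν 1 f := rfl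

theorem coe_shiftHTwo_pow (n : ℕ) (f : HTwo ν) :
    ((shiftHTwo ν ^ n) f : LTwo ν) = fourierMul ν n f := by
  induction n with
  | zero => exact (fourierMul_zero ν _).symm
  | succ n ih =>
    rw [pow_succ', LinearIsometry.coe_mul, Function.comp_apply, coe_shiftHTwo, ih,
      fourierMul_fourierMul, Nat.cast_succ, add_comm]

theorem polyHTwo_add (p q : Polynomial ℂ) :
    polyHTwo ν (p + q) = polyHTwo ν p + polyHTwo ν q := by
  have h : polyOnCircle (p + q) = polyOnCircle p + polyOnCircle q := by
    ext θ
    simp [polyOnCircle]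
  exact Subtype.ext (by simp [polyHTwo, polyLTwo, h, map_add])

theorem polyHTwo_C (a : ℂ) : polyHTwo ν (Polynomial.C a) = a • polyHTwo ν 1 := by
  have h : polyOnCircle (Polynomial.C a) = a • polyOnCircle 1 := by
    ext θ
    simp [polyOnCircle]
  exact Subtype.ext (by simp [polyHTwo, polyLTwo, h, map_smul])

theorem polyHTwo_X_mul (p : Polynomial ℂ) :
    polyHTwo ν (Polynomial.X * p) = shiftHTwo ν (polyHTwo ν p) :=
  Subtype.ext (polyLTwo_X_mul ν p)

theorem aeval_shiftHTwo_polyHTwo_one (p : Polynomial ℂ) :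
    Polynomial.aeval (shiftHTwo ν).toLinearMap p (polyHTwo ν 1) = polyHTwo ν p := by
  induction p using Polynomial.induction_on with
  | C a => simp [polyHTwo_C]
  | add p q hp hq => rw [map_add, LinearMap.add_apply, hp, hq, polyHTwo_add]
  | monomial n a h =>
    rw [pow_succ', mul_left_comm, map_mul, Polynomial.aeval_X, Module.End.mul_apply, h,
      LinearIsometry.coe_toLinearMap, polyHTwo_X_mul]

variable {ν}

theorem fourierMul_mem_HTwo_of_surjective (h : Function.Surjective (shiftHTwo ν)) (n : ℤ)
    {f : LTwo ν} (hf : f ∈ HTwo ν) : fourierMul ν n f ∈ HTwo ν := by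
  induction n with
  | zero => rwa [fourierMul_zero]
  | succ n ih =>
    rw [add_comm, ← fourierMul_fourierMul]
    exact fourierMul_one_mem_HTwo ih
  | pred n ih =>
    obtain ⟨g, hg⟩ := h ⟨_, ih⟩
    have hgf : fourierMul ν 1 g = fourierMul ν (-n) f := congrArg Subtype.val hg
    rw [sub_eq_add_neg, add_comm, ← fourierMul_fourierMul, ← hgf, fourierMul_fourierMul,
      neg_add_cancel, fourierMul_zero]
    exact g.2

theorem HTwo_eq_top_of_surjective (h : Function.Surjective (shiftHTwo ν)) : HTwo ν = ⊤ := by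
  rw [eq_top_iff, ← topologicalClosure_span_toLp_fourier (p := 2) ν ENNReal.ofNat_ne_top]
  refine Submodule.topologicalClosure_minimal _ (Submodule.span_le.2 ?_)
    (Submodule.isClosed_topologicalClosure _)
  rintro _ ⟨n, rfl⟩
  have hone : polyOnCircle 1 = 1 := by
    ext θ
    simp [polyOnCircle]
  have hmem := fourierMul_mem_HTwo_of_surjective h n (polyLTwo_mem_HTwo ν 1)
  rwa [polyLTwo, fourierMul_toLp, hone, mul_one] at hmem

namespace IsUnitWandering

variable {e f : HTwo ν}

theorem inner_fourierMul_neg (he : IsUnitWandering (shiftHTwo ν) e) (n : ℕ) (g : HTwo ν) :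
    inner ℂ (fourierMul ν (-(n + 1 : ℕ)) e) (g : LTwo ν) = 0 := by
  rw [inner_fourierMul_left, neg_neg, ← coe_shiftHTwo_pow]
  exact he.inner_pow_succ n g

theorem inner_fourierMul_self (he : IsUnitWandering (shiftHTwo ν) e) {n : ℤ} (hn : n ≠ 0) :
    inner ℂ (fourierMul ν n e) (e : LTwo ν) = 0 := by
  obtain ⟨m, rfl | rfl⟩ := n.eq_nat_or_neg
  all_goals obtain ⟨k, rfl⟩ := Nat.exists_eq_succ_of_ne_zero (by simpa using hn : m ≠ 0)
  · rw [inner_fourierMul_left]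
    exact inner_eq_zero_symm.1 (he.inner_fourierMul_neg k e)
  · exact he.inner_fourierMul_neg k e

/-- The negative Fourier coefficients of `ē f dν` vanish as `e ⟂ z H₂(dν)`. -/
theorem eq_zero_of_inner_pow_eq_zero (he : IsUnitWandering (shiftHTwo ν) e) (hν : ν ≪ volume)
    (hf : ∀ n : ℕ, inner ℂ ((shiftHTwo ν ^ n) e) f = 0) : f = 0 := by
  have hhaar : ν ≪ AddCircle.haarAddCircle := by
    rw [AddCircle.volume_eq_smul_haarAddCircle] at hν
    exact hν.trans Measure.smul_absolutelyContinuous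
  have hall (n : ℤ) : inner ℂ (fourierMul ν n e) (f : LTwo ν) = 0 := by
    cases n with
    | ofNat n => exact coe_shiftHTwo_pow ν n e ▸ hf n
    | negSucc n => exact he.inner_fourierMul_neg n f
  exact Subtype.ext <| eq_zero_of_inner_fourierMul_eq_zero hhaar he.norm_eq_one
    (fun _ => he.inner_fourierMul_self) hall

theorem inner_wanderingKernel_polyHTwo_one_ne_zero (he : IsUnitWandering (shiftHTwo ν) e) {w : ℂ}
    (hw : ‖w‖ < 1) : inner ℂ (wanderingKernel (shiftHTwo ν) e w) (polyHTwo ν 1) ≠ 0 := by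
  refine he.inner_wanderingKernel_ne_zero (fun x hx => ?_) hw
  simp only [aeval_shiftHTwo_polyHTwo_one] at hx
  exact eq_zero_of_inner_polyHTwo_eq_zero hx

theorem inner_evalVector_polyHTwo (he : IsUnitWandering (shiftHTwo ν) e) {w : ℂ} (hw : ‖w‖ < 1)
    (p : Polynomial ℂ) :
    inner ℂ (evalVector (shiftHTwo ν) e (polyHTwo ν 1) w) (polyHTwo ν p) = p.eval w := by
  rw [← aeval_shiftHTwo_polyHTwo_one ν p, he.inner_evalVector_aeval
    (he.inner_wanderingKernel_polyHTwo_one_ne_zero hw) hw]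

theorem eq_zero_of_inner_evalVector_eq_zero (he : IsUnitWandering (shiftHTwo ν) e)
    (hν : ν ≪ volume)
    (hf : ∀ w : ℂ, ‖w‖ < 1 → inner ℂ (evalVector (shiftHTwo ν) e (polyHTwo ν 1) w) f = 0) :
    f = 0 := by
  refine he.eq_zero_of_inner_pow_eq_zero hν fun n =>
    inner_eq_zero_of_inner_szegoVector_eq_zero he.orthonormal_pow (fun w hw => ?_) n
  have hfw := hf w hw
  rw [evalVector, inner_smul_left, RCLike.conj_conj] at hfw
  exact (mul_eq_zero.1 hfw).resolve_left
    (inv_ne_zero (he.inner_wanderingKernel_polyHTwo_one_ne_zero hw))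

end IsUnitWandering

end ShiftHTwo

section SzegoFunction

/-- The reciprocal of a function `φ` on the unit disc, continued to the exterior of the disc by the
reflection `A(z) A(1 / z*)* = 1`. -/
def reflectedInv (φ : ℂ → ℂ) (z : ℂ) : ℂ :=
  if ‖z‖ < 1 then (φ z)⁻¹ else conj (φ (conj z)⁻¹)

theorem analyticOnNhd_reflectedInv {φ : ℂ → ℂ} (hφ : DifferentiableOn ℂ φ (Metric.ball 0 1))
    (hne : ∀ z ∈ Metric.ball (0 : ℂ) 1, φ z ≠ 0) :
    AnalyticOnNhd ℂ (reflectedInv φ) {z : ℂ | ‖z‖ ≠ 1} := by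
  have hopen : IsOpen {z : ℂ | ‖z‖ ≠ 1} := isOpen_ne_fun continuous_norm continuous_const
  refine DifferentiableOn.analyticOnNhd ?_ hopen
  refine fun z hz => DifferentiableAt.differentiableWithinAt ?_
  have hdiff {w : ℂ} (hw : w ∈ Metric.ball (0 : ℂ) 1) : DifferentiableAt ℂ φ w :=
    hφ.differentiableAt (Metric.isOpen_ball.mem_nhds hw)
  rcases lt_or_gt_of_ne hz with hlt | hgt
  · have hball := mem_ball_zero_iff.2 hlt
    refine ((hdiff hball).inv (hne z hball)).congr_of_eventuallyEq ?_
    filter_upwards [Metric.isOpen_ball.mem_nhds hball] with w hw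
    exact if_pos (mem_ball_zero_iff.1 hw)
  · have hz0 : z ≠ 0 := norm_pos_iff.1 (one_pos.trans hgt)
    have hball : conj z⁻¹ ∈ Metric.ball (0 : ℂ) 1 := by
      rw [mem_ball_zero_iff, RCLike.norm_conj, norm_inv]
      exact inv_lt_one_of_one_lt₀ hgt
    have hcomp : DifferentiableAt ℂ (fun w => conj (φ (conj w⁻¹))) z :=
      (Complex.conj_conj z⁻¹ ▸ (hdiff hball).conj_conj).comp z (differentiableAt_inv hz0)
    refine hcomp.congr_of_eventuallyEq ?_
    filter_upwards [(isOpen_lt continuous_const continuous_norm).mem_nhds hgt] with w hw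
    rw [reflectedInv, if_neg (not_lt_of_gt hw), map_inv₀]

variable {ν : Measure (AddCircle (2 * Real.pi))} [IsFiniteMeasure ν] {e : HTwo ν}

/-- The Szegő function of `ν`, where `e` is a unit vector of `H₂(dν)` orthogonal to `z H₂(dν)`. -/
def szegoFunction (e : HTwo ν) : ℂ → ℂ :=
  reflectedInv fun w => inner ℂ (wanderingKernel (shiftHTwo ν) e w) (polyHTwo ν 1)

theorem IsUnitWandering.analyticOnNhd_szegoFunction (he : IsUnitWandering (shiftHTwo ν) e) :
    AnalyticOnNhd ℂ (szegoFunction e) {z : ℂ | ‖z‖ ≠ 1} :=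
  analyticOnNhd_reflectedInv (differentiableOn_inner_szegoVector he.orthonormal_pow _) fun _ hz =>
    he.inner_wanderingKernel_polyHTwo_one_ne_zero (mem_ball_zero_iff.1 hz)

theorem IsUnitWandering.inner_evalVector_eq_differenceKernel
    (he : IsUnitWandering (shiftHTwo ν) e) {z w : ℂ} (hz : ‖z‖ < 1) (hw : ‖w‖ < 1) :
    inner ℂ (evalVector (shiftHTwo ν) e (polyHTwo ν 1) z)
        (evalVector (shiftHTwo ν) e (polyHTwo ν 1) w) =
      differenceKernel (szegoFunction e) 0 z w := by
  rw [he.inner_evalVector_evalVector hz hw, differenceKernel, szegoFunction, reflectedInv,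
    reflectedInv, if_pos hz, if_pos hw, Pi.zero_apply, zero_mul, sub_zero]

end SzegoFunction

section OfTotal

variable {𝕜 H X : Type*} [RCLike 𝕜] [NormedAddCommGroup H] [InnerProductSpace 𝕜 H]
  (k : X → H) (hk : ∀ f, (∀ x, inner 𝕜 (k x) f = 0) → f = 0)

/-- The reproducing kernel space structure on a Hilbert space with a total family `k` of vectors, in
which `f` is identified with the function `x ↦ ⟪k x, f⟫`. -/
@[reducible]
def rkhsOfTotal : RKHS 𝕜 H X 𝕜 where
  coeCLM := ContinuousLinearMap.pi fun x => innerSL 𝕜 (k x)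
  coeCLM_injective := (injective_iff_map_eq_zero _).2 fun f hf => hk f fun x => congrFun hf x

theorem kernel_rkhsOfTotal [CompleteSpace H] (x y : X) :
    letI := rkhsOfTotal k hk
    RKHS.kernel H x y 1 = inner 𝕜 (k x) (k y) := by
  let := rkhsOfTotal k hk
  have hy : RKHS.kerFun H y (1 : 𝕜) = k y := by
    refine ext_inner_right 𝕜 fun f => (RKHS.kerFun_inner y 1 f).trans ?_
    rw [RCLike.inner_apply, map_one, mul_one]
    rfl
  rw [← RKHS.kerFun_apply, hy]
  rfl

end OfTotal

end

theorem mainTheorem11 (ν : Measure (AddCircle (2 * Real.pi))) [IsFiniteMeasure ν]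
    (hν : HTwo ν ≠ ⊤) :
    ∃ (k : Metric.ball (0 : ℂ) 1 → HTwo ν) (A B : ℂ → ℂ),
      IsReproducingFamily ν k ∧
      AnalyticOnNhd ℂ A {z : ℂ | ‖z‖ ≠ 1} ∧
      AnalyticOnNhd ℂ B {z : ℂ | ‖z‖ ≠ 1} ∧
      (∀ z w : Metric.ball (0 : ℂ) 1, inner ℂ (k z) (k w) = differenceKernel A B z w) ∧
      (ν ≪ volume →
        ∃ _ : RKHS ℂ (HTwo ν) (Metric.ball (0 : ℂ) 1) ℂ,
          (∀ (p : Polynomial ℂ) (w : Metric.ball (0 : ℂ) 1),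
            (polyHTwo ν p : Metric.ball (0 : ℂ) 1 → ℂ) w = p.eval (w : ℂ)) ∧
          ∀ z w : Metric.ball (0 : ℂ) 1,
            RKHS.kernel (HTwo ν) z w 1 = differenceKernel A B z w) := by
  obtain ⟨e, he⟩ := exists_isUnitWandering (mt HTwo_eq_top_of_surjective hν)
  have hball (w : Metric.ball (0 : ℂ) 1) : ‖(w : ℂ)‖ < 1 := mem_ball_zero_iff.1 w.2
  let k (w : Metric.ball (0 : ℂ) 1) : HTwo ν := evalVector (shiftHTwo ν) e (polyHTwo ν 1) w
  have hrepr : IsReproducingFamily ν k := fun w => he.inner_evalVector_polyHTwo (hball w)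
  have hkernel (z w : Metric.ball (0 : ℂ) 1) :
      inner ℂ (k z) (k w) = differenceKernel (szegoFunction e) 0 z w :=
    he.inner_evalVector_eq_differenceKernel (hball z) (hball w)
  refine ⟨k, szegoFunction e, 0, hrepr, he.analyticOnNhd_szegoFunction, analyticOnNhd_const,
    hkernel, fun hac => ?_⟩
  have htotal (f : HTwo ν) (hf : ∀ w, inner ℂ (k w) f = 0) : f = 0 :=
    he.eq_zero_of_inner_evalVector_eq_zero hac fun w hw => hf ⟨w, mem_ball_zero_iff.2 hw⟩
  exact ⟨rkhsOfTotal k htotal, fun p w => hrepr w p,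
    fun z w => (kernel_rkhsOfTotal k htotal z w).trans (hkernel z w)⟩
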